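/- Let $H$ be an infinite-dimensional complex Hilbert space and let $I$ be a non-empty index set with $|I| \le \dim H$, where $\dim H$ is the Hilbert space dimension, i.e. the cardinality of an orthonormal basis of $H$. Let $\{T_i\}_{i\in I}$ be a family of (not necessarily commuting) contractive $C_0$-semigroups on $H$, i.e. each $T_i : [0,\infty) \to B(H)$ is strongly continuous with $T_i(0) = 1$, $T_i(s+t) = T_i(s)T_i(t)$ and $\|T_i(t)\| \le 1$ for all $s,t \ge 0$. Then there exist a non-empty directed set $\Lambda$ and a net $(\{U_i^{(\alpha)}\}_{i\in I})_{\alpha\in\Lambda}$ of families of strongly continuous unitary representations of $\mathbb{R}$ on $H$ such that for all $\xi,\eta\in H$ $$\sup_{\substack{N\in\mathbb{N}_0,\\ i_1,\dots,i_N\in I,\\ t_1,\dots,t_N\ge 0}} \left|\left\langle \left(\prod_{k=1}^N T_{i_k}(t_k) - \prod_{k=1}^N U^{(\alpha)}_{i_k}(t_k)\right)\xi,\ \eta\right\rangle\right| \xrightarrow[\alpha]{} 0,$$ where the factors of the products are ordered from left to right by increasing $k$ and empty products are the identity. -/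

import Mathlib

open scoped NNReal ENNReal

universe u v

/-- The Hilbert space dimension: the least cardinality of an orthonormal (Hilbert) basis.
(All orthonormal bases of a Hilbert space have the same cardinality, and one exists.) -/
noncomputable def hilbertDim (H : Type v) [NormedAddCommGroup H] [InnerProductSpace ℂ H] :
    Cardinal.{v} :=
  sInf {c : Cardinal.{v} | ∃ s : Set H, Nonempty (HilbertBasis s ℂ H) ∧ Cardinal.mk s = c}

/-- `T` is a contractive `C₀`-semigroup on `H`: a strongly continuous one-parameter semigroup
of contractions over `[0, ∞)`. -/
structure IsContractiveC0Semigroup {H : Type*} [NormedAddCommGroup H] [InnerProductSpace ℂ H]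
    (T : ℝ≥0 → (H →L[ℂ] H)) : Prop where
  map_zero : T 0 = 1
  map_add : ∀ s t : ℝ≥0, T (s + t) = T s * T t
  norm_le_one : ∀ t : ℝ≥0, ‖T t‖ ≤ 1
  continuous_apply : ∀ ξ : H, Continuous fun t : ℝ≥0 => T t ξ

/-- A strongly (SOT-)continuous unitary representation of the additive group `ℝ` on `H`. -/
structure SOTContinuousUnitaryRep (H : Type*) [NormedAddCommGroup H] [InnerProductSpace ℂ H]
    [CompleteSpace H] where
  rep : Multiplicative ℝ →* unitary (H →L[ℂ] H)
  continuous_apply : ∀ ξ : H,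
    Continuous fun t : ℝ => (rep (Multiplicative.ofAdd t) : H →L[ℂ] H) ξ

/-- The operator `U(t)` of a unitary representation of `ℝ` at time `t`. -/
noncomputable def SOTContinuousUnitaryRep.op {H : Type*} [NormedAddCommGroup H] [InnerProductSpace ℂ H]
    [CompleteSpace H] (U : SOTContinuousUnitaryRep H) (t : ℝ) : H →L[ℂ] H :=
  (U.rep (Multiplicative.ofAdd t) : H →L[ℂ] H)

/-! Each $T_i$ has a unitary dilation $V_i$ on a space $K_i \supseteq H$ (`exists_unitaryDilation`).
It has a closed "future" subspace containing $H$, invariant under $V_i(t)$ for $t \ge 0$, on which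
the projection to $H$ intertwines $V_i(t)$ with $T_i(t)$. Since $K_i$ is no bigger than $H$, it sits
in $H \oplus H \oplus H$ with coordinates: the copy of $H$, the rest of the future, the complement
of the future. The subspace "third coordinate zero" is the same for every $i$. On it, each group for
$t \ge 0$ preserves the subspace and acts on the first coordinate as $T_i(t)$, so mixed words need
no common dilation (`exists_prod_apply_eq`). For a finite set $s \subseteq H$, an isometry $w$ of $H
\oplus H \oplus H$ into $H$ with $w(x,0,0) = x$ on $s$ carries these groups to $H$
(`exists_linearIsometry_triple`). For $\xi, \eta \in s$ all matrix coefficients then agree exactly,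
so the net over finite sets is eventually zero. -/

/-! ### Positivity of the Toeplitz kernel -/

section Kernel

variable {H : Type*} [NormedAddCommGroup H] [InnerProductSpace ℂ H] [CompleteSpace H]

/-- The extension of `T : ℝ≥0 → B(H)` to `ℝ` by `T (-t) = (T t)†`. -/
noncomputable def twoSided (T : ℝ≥0 → (H →L[ℂ] H)) (t : ℝ) : H →L[ℂ] H :=
  if 0 ≤ t then T t.toNNReal else ContinuousLinearMap.adjoint (T (-t).toNNReal)

/-- The Toeplitz kernel of a one-parameter semigroup. -/
noncomputable def toeplitzKernel (T : ℝ≥0 → (H →L[ℂ] H)) : Matrix ℝ ℝ (H →L[ℂ] H) :=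
  Matrix.of fun x y => twoSided T (y - x)

variable {T : ℝ≥0 → (H →L[ℂ] H)}

theorem twoSided_of_nonneg {t : ℝ} (ht : 0 ≤ t) : twoSided T t = T t.toNNReal := if_pos ht

theorem twoSided_coe (t : ℝ≥0) : twoSided T t = T t := by
  simp [twoSided]

theorem IsContractiveC0Semigroup.twoSided_zero (hT : IsContractiveC0Semigroup T) :
    twoSided T 0 = 1 := by
  simp [twoSided, hT.map_zero]

theorem IsContractiveC0Semigroup.adjoint_twoSided (hT : IsContractiveC0Semigroup T) (t : ℝ) :
    ContinuousLinearMap.adjoint (twoSided T t) = twoSided T (-t) := by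
  rcases lt_trichotomy t 0 with h | rfl | h
  · rw [twoSided, if_neg h.not_ge, twoSided, if_pos (by linarith),
      ContinuousLinearMap.adjoint_adjoint]
  · rw [neg_zero, hT.twoSided_zero, ← ContinuousLinearMap.star_eq_adjoint, star_one]
  · rw [twoSided, if_pos h.le, twoSided, if_neg (by linarith), neg_neg]

theorem IsContractiveC0Semigroup.twoSided_add (hT : IsContractiveC0Semigroup T) {s t : ℝ}
    (hs : 0 ≤ s) (ht : 0 ≤ t) : twoSided T (s + t) = twoSided T s * twoSided T t := by
  rw [twoSided_of_nonneg hs, twoSided_of_nonneg ht, twoSided_of_nonneg (add_nonneg hs ht),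
    Real.toNNReal_add hs ht, hT.map_add]

theorem IsContractiveC0Semigroup.norm_twoSided_le (hT : IsContractiveC0Semigroup T) (t : ℝ) :
    ‖twoSided T t‖ ≤ 1 := by
  unfold twoSided
  split_ifs
  · exact hT.norm_le_one _
  · rw [LinearIsometryEquiv.norm_map]
    exact hT.norm_le_one _

theorem IsContractiveC0Semigroup.re_inner_twoSided_comm (hT : IsContractiveC0Semigroup T)
    (t : ℝ) (u v : H) :
    (inner ℂ (twoSided T t u) v).re = (inner ℂ (twoSided T (-t) v) u).re := by
  rw [← hT.adjoint_twoSided, ContinuousLinearMap.adjoint_inner_left, ← inner_conj_symm,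
    Complex.conj_re]

/-- Induction on the largest point $a$. With $m$ the next largest and $c = T(a-m)f(a)$, the
semigroup law turns the cross terms at $a$ into those of $c$ placed at $m$. The form is thus that of
$f + c\,\delta_m$ on the remaining points plus $\|f(a)\|^2 - \|c\|^2 \ge 0$. -/
theorem IsContractiveC0Semigroup.re_sum_inner_twoSided_nonneg (hT : IsContractiveC0Semigroup T)
    (s : Finset ℝ) : ∀ f : ℝ → H,
      0 ≤ ∑ x ∈ s, ∑ y ∈ s, (inner ℂ (twoSided T (x - y) (f x)) (f y)).re := by
  induction s using Finset.induction_on_max with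
  | empty => simp
  | insert a s ha ih =>
    intro f
    have has : a ∉ s := fun h => lt_irrefl _ (ha a h)
    have hsymm : ∀ g : ℝ → H, ∀ b, ∀ u : H,
        ∑ x ∈ s, (inner ℂ (twoSided T (x - b) (g x)) u).re
          = ∑ x ∈ s, (inner ℂ (twoSided T (b - x) u) (g x)).re := fun g b u =>
      Finset.sum_congr rfl fun x _ => by rw [hT.re_inner_twoSided_comm, neg_sub]
    have hself : (inner ℂ (twoSided T (a - a) (f a)) (f a)).re = ‖f a‖ ^ 2 := by
      rw [sub_self, hT.twoSided_zero]
      exact inner_self_eq_norm_sq (𝕜 := ℂ) (f a)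
    rw [Finset.sum_insert has, Finset.sum_insert has]
    simp_rw [Finset.sum_insert has]
    rw [Finset.sum_add_distrib, hself, hsymm]
    rcases s.eq_empty_or_nonempty with rfl | hne
    · simp
    set m := s.max' hne with hm
    have hms : m ∈ s := s.max'_mem hne
    have hma : 0 ≤ a - m := (sub_pos.2 (ha m hms)).le
    set c : H := twoSided T (a - m) (f a) with hc
    have hcn : ‖c‖ ^ 2 ≤ ‖f a‖ ^ 2 := by
      gcongr
      calc ‖c‖ ≤ 1 * ‖f a‖ := (twoSided T (a - m)).le_of_opNorm_le (hT.norm_twoSided_le _) _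
        _ = ‖f a‖ := one_mul _
    have hfac : ∑ x ∈ s, (inner ℂ (twoSided T (a - x) (f a)) (f x)).re
        = ∑ x ∈ s, (inner ℂ (twoSided T (m - x) c) (f x)).re := by
      refine Finset.sum_congr rfl fun x hx => ?_
      have hmx : 0 ≤ m - x := sub_nonneg.2 (s.le_max' x hx)
      rw [show a - x = (m - x) + (a - m) by ring, hT.twoSided_add hmx hma]
      rfl
    rw [hfac]
    have key := ih (fun x => f x + if x = m then c else 0)
    have hself' : (inner ℂ (twoSided T (m - m) c) c).re = ‖c‖ ^ 2 := by
      rw [sub_self, hT.twoSided_zero]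
      exact inner_self_eq_norm_sq (𝕜 := ℂ) c
    have hexp : ∑ x ∈ s, ∑ y ∈ s, (inner ℂ (twoSided T (x - y) (f x + if x = m then c else 0))
          (f y + if y = m then c else 0)).re
        = ∑ x ∈ s, ∑ y ∈ s, (inner ℂ (twoSided T (x - y) (f x)) (f y)).re
          + ∑ x ∈ s, (inner ℂ (twoSided T (x - m) (f x)) c).re
          + ∑ y ∈ s, (inner ℂ (twoSided T (m - y) c) (f y)).re
          + (inner ℂ (twoSided T (m - m) c) c).re := by
      have h1 : ∀ x y, (inner ℂ (twoSided T (x - y) (f x + if x = m then c else 0))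
          (f y + if y = m then c else 0)).re
          = (inner ℂ (twoSided T (x - y) (f x)) (f y)).re
          + (if y = m then (inner ℂ (twoSided T (x - y) (f x)) c).re else 0)
          + (if x = m then (inner ℂ (twoSided T (x - y) c) (f y)).re else 0)
          + (if x = m then if y = m then (inner ℂ (twoSided T (x - y) c) c).re else 0 else 0) := by
        intro x y
        split_ifs <;> simp [inner_add_left, inner_add_right]
        ring
      simp_rw [h1, Finset.sum_add_distrib]
      congr 1
      · congr 1
        · congr 1
          simp [hms]
        · rw [Finset.sum_comm]
          simp [hms]
      · rw [Finset.sum_eq_single_of_mem m hms (fun x _ hx => by simp [hx])]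
        simp [hms]
    rw [hexp, hsymm, hself'] at key
    linarith

theorem IsContractiveC0Semigroup.posSemidef_toeplitzKernel (hT : IsContractiveC0Semigroup T) :
    (toeplitzKernel T).PosSemidef := by
  have h := RKHS.posSemidef_tfae (K := toeplitzKernel T)
  have h := h.out 0 2
  refine h.mpr ⟨?_, fun f => ?_⟩
  · ext1 x y
    rw [Matrix.conjTranspose_apply]
    change ContinuousLinearMap.adjoint (twoSided T (x - y)) = twoSided T (y - x)
    rw [hT.adjoint_twoSided, neg_sub]
  · simpa [Finsupp.sum, toeplitzKernel] using hT.re_sum_inner_twoSided_nonneg f.support f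

end Kernel

/-! ### Total families and isometries -/

section Total

variable {X Y γ : Type*} [NormedAddCommGroup X] [InnerProductSpace ℂ X]
  [NormedAddCommGroup Y] [InnerProductSpace ℂ Y]

/-- A family of vectors is total if its closed linear span is the whole space. -/
def IsTotalFamily (a : γ → X) : Prop :=
  (Submodule.span ℂ (Set.range a)).topologicalClosure = ⊤

theorem IsTotalFamily.denseRange_linearCombination {a : γ → X} (ha : IsTotalFamily a) :
    DenseRange (Finsupp.linearCombination ℂ a) := by
  rw [DenseRange, ← LinearMap.coe_range, Finsupp.range_linearCombination]
  exact Submodule.dense_iff_topologicalClosure_eq_top.2 ha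

theorem IsTotalFamily.induction {a : γ → X} (ha : IsTotalFamily a) {p : Submodule ℂ X}
    (hp : IsClosed (p : Set X)) (h : ∀ i, a i ∈ p) (x : X) : x ∈ p := by
  have hle : (Submodule.span ℂ (Set.range a)).topologicalClosure ≤ p :=
    Submodule.topologicalClosure_minimal _ (Submodule.span_le.2 (Set.range_subset_iff.2 h)) hp
  exact hle (ha ▸ Submodule.mem_top)

theorem isTotalFamily_of_forall_mem {a : γ → X}
    (h : ∀ p : Submodule ℂ X, IsClosed (p : Set X) → (∀ i, a i ∈ p) → ∀ x, x ∈ p) :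
    IsTotalFamily a :=
  (Submodule.eq_top_iff').2 <| h _ (Submodule.isClosed_topologicalClosure _) fun i =>
    Submodule.le_topologicalClosure _ (Submodule.subset_span ⟨i, rfl⟩)

/-- Equal Gram matrices give corresponding finite combinations equal norms; density extends the map.
-/
theorem IsTotalFamily.exists_linearIsometry [CompleteSpace Y] {a : γ → X} (ha : IsTotalFamily a) (b : γ → Y)
    (h : ∀ i j, inner ℂ (a i) (a j) = inner ℂ (b i) (b j)) :
    ∃ L : X →ₗᵢ[ℂ] Y, ∀ i, L (a i) = b i := by
  have hn : ∀ f : γ →₀ ℂ,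
      ‖Finsupp.linearCombination ℂ b f‖ = ‖Finsupp.linearCombination ℂ a f‖ := by
    intro f
    rw [← sq_eq_sq₀ (norm_nonneg _) (norm_nonneg _), ← inner_self_eq_norm_sq (𝕜 := ℂ),
      ← inner_self_eq_norm_sq (𝕜 := ℂ)]
    simp only [Finsupp.linearCombination_apply, Finsupp.sum_inner, Finsupp.inner_sum, h,
      inner_smul_left, inner_smul_right]
  have hd := ha.denseRange_linearCombination
  have he := LinearMap.extendOfNorm_eq (f := Finsupp.linearCombination ℂ b) hd
    ⟨1, fun f => by rw [one_mul, hn]⟩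
  refine ⟨⟨((Finsupp.linearCombination ℂ b).extendOfNorm
    (Finsupp.linearCombination ℂ a)).toLinearMap, ?_⟩, fun i => ?_⟩
  · refine hd.induction ?_ (isClosed_eq (by simp only [ContinuousLinearMap.coe_coe]; fun_prop)
      continuous_norm)
    rintro _ ⟨f, rfl⟩
    exact (congrArg norm (he f)).trans (hn f)
  · simpa using he (Finsupp.single i 1)

/-- The vectors on which a uniformly bounded family of operators is strongly continuous form a
closed subspace. -/
theorem exists_isClosed_continuous_apply (V : ℝ → X →ₗᵢ[ℂ] Y) :
    ∃ p : Submodule ℂ X, IsClosed (p : Set X) ∧ ∀ x, x ∈ p ↔ Continuous fun t => V t x := by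
  refine ⟨{ carrier := {x | Continuous fun t => V t x}
            add_mem' := fun {x y} hx hy => by
              change Continuous fun t => V t (x + y)
              simp only [map_add]
              exact Continuous.add hx hy
            zero_mem' := by simpa using continuous_const
            smul_mem' := fun c x hx => by
              change Continuous fun t => V t (c • x)
              simp only [map_smul]
              exact Continuous.const_smul hx c },
    ?_, fun x => Iff.rfl⟩
  -- As each `V t` is isometric, approximation of `x` is uniform in `t`.
  refine isClosed_of_closure_subset fun x hx => ?_
  refine continuous_of_uniform_approx_of_continuous fun u hu => ?_
  obtain ⟨ε, hε, hεu⟩ := Metric.mem_uniformity_dist.1 hu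
  obtain ⟨y, hy, hxy⟩ := Metric.mem_closure_iff.1 hx ε hε
  exact ⟨fun t => V t y, hy, fun t => hεu (by rwa [(V t).dist_map])⟩

end Total

/-! ### Unitary dilation of one semigroup -/

section Dilation

/-- A unitary dilation `V` of the one-parameter semigroup `T`, with the embedding `emb` of the
original space and a subspace `future` that contains it, is invariant under `V t` for `t ≥ 0`, and
is such that the compression of `V t` to it is a lift of `T t`. -/
structure UnitaryDilation {H : Type*} [NormedAddCommGroup H] [InnerProductSpace ℂ H]
    [CompleteSpace H] (T : ℝ≥0 → (H →L[ℂ] H)) (K : Type*) [NormedAddCommGroup K]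
    [InnerProductSpace ℂ K] [CompleteSpace K] where
  V : ℝ → K →ₗᵢ[ℂ] K
  V_zero : ∀ x, V 0 x = x
  V_add : ∀ s t x, V (s + t) x = V s (V t x)
  continuous_V : ∀ x, Continuous fun t => V t x
  emb : H →ₗᵢ[ℂ] K
  future : Submodule ℂ K
  isClosed_future : IsClosed (future : Set K)
  emb_mem : ∀ h, emb h ∈ future
  V_mem : ∀ (t : ℝ≥0), ∀ x ∈ future, V t x ∈ future
  adjoint_V : ∀ (t : ℝ≥0), ∀ x ∈ future,
    ContinuousLinearMap.adjoint emb.toContinuousLinearMap (V t x)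
      = T t (ContinuousLinearMap.adjoint emb.toContinuousLinearMap x)

/-- The real part is even in `t`, so only strong continuity of $T$ itself is needed, not that of the
adjoints. -/
theorem IsContractiveC0Semigroup.continuous_twoSided_inner {H : Type*} [NormedAddCommGroup H]
    [InnerProductSpace ℂ H] [CompleteSpace H] {T : ℝ≥0 → (H →L[ℂ] H)}
    (hT : IsContractiveC0Semigroup T) (h : H) :
    Continuous fun t : ℝ => (inner ℂ (twoSided T t h) h).re := by
  have : (fun t : ℝ => (inner ℂ (twoSided T t h) h).re)
      = fun t : ℝ => (inner ℂ (T (Real.toNNReal |t|) h) h).re := by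
    funext t
    rcases le_total 0 t with ht | ht
    · rw [abs_of_nonneg ht, twoSided_of_nonneg ht]
    · rw [abs_of_nonpos ht, hT.re_inner_twoSided_comm, twoSided_of_nonneg (by linarith)]
  rw [this]
  have := (hT.continuous_apply h).comp (continuous_real_toNNReal.comp continuous_abs)
  exact Complex.continuous_re.comp (this.inner continuous_const)

/-- In the RKHS of the Toeplitz kernel, $\langle k_x u, k_y v\rangle$ depends on $x, y$ only through
$x-y$, so translation of the sections $k_t h$ is isometric. The future is spanned by the sections
with $t \ge 0$. The rational-time family `d` bounds the size of $K$. -/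
theorem IsContractiveC0Semigroup.exists_unitaryDilation {H : Type v} [NormedAddCommGroup H]
    [InnerProductSpace ℂ H] [CompleteSpace H] {T : ℝ≥0 → (H →L[ℂ] H)}
    (hT : IsContractiveC0Semigroup T) {σ : Type*} {b : σ → H} (hb : IsTotalFamily b) :
    ∃ (K : Type v) (_ : NormedAddCommGroup K) (_ : InnerProductSpace ℂ K) (_ : CompleteSpace K)
      (_ : UnitaryDilation T K) (d : ℚ × σ → K), IsTotalFamily d := by
  have : Fact (toeplitzKernel T).PosSemidef := ⟨hT.posSemidef_toeplitzKernel⟩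
  set K := RKHS.OfKernel (toeplitzKernel T) with hK
  set k : ℝ → H →L[ℂ] K := RKHS.kerFun K with hkdef
  have hk : ∀ x y u v, inner ℂ (k x u) (k y v) = inner ℂ (twoSided T (x - y) u) v := by
    intro x y u v
    rw [hkdef, ← RKHS.kernel_inner, RKHS.OfKernel.kernel_ofKernel]
    rfl
  have htot : IsTotalFamily fun p : ℝ × H => k p.1 p.2 := by
    have := RKHS.kerFun_dense K
    rw [IsTotalFamily, ← this]
    congr 2
    ext x
    simp [hkdef]
  have hnorm : ∀ x u, ‖k x u‖ = ‖u‖ := by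
    intro x u
    rw [← sq_eq_sq₀ (norm_nonneg _) (norm_nonneg _), ← inner_self_eq_norm_sq (𝕜 := ℂ),
      ← inner_self_eq_norm_sq (𝕜 := ℂ), hk, sub_self, hT.twoSided_zero]
    rfl
  have hVex : ∀ s : ℝ, ∃ L : K →ₗᵢ[ℂ] K, ∀ p : ℝ × H, L (k p.1 p.2) = k (s + p.1) p.2 := fun s =>
    htot.exists_linearIsometry _ fun p q => by rw [hk, hk]; congr 3; ring
  choose V hV using hVex
  have hV' : ∀ s t h, V s (k t h) = k (s + t) h := fun s t h => hV s (t, h)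
  have hkc : ∀ h, Continuous fun t => k t h := by
    intro h
    have hd : ∀ s t, ‖k t h - k s h‖ ^ 2
        = 2 * ‖h‖ ^ 2 - 2 * (inner ℂ (twoSided T (t - s) h) h).re := by
      intro s t
      rw [@norm_sub_sq ℂ, hnorm, hnorm, hk]
      simp only [RCLike.re_eq_complex_re]
      ring
    refine continuous_iff_continuousAt.2 fun s => ?_
    rw [ContinuousAt, tendsto_iff_norm_sub_tendsto_zero]
    have hc : Continuous fun t => ‖k t h - k s h‖ ^ 2 := by
      simp_rw [hd]
      have := (hT.continuous_twoSided_inner h).comp (continuous_id.sub (continuous_const (y := s)))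
      exact continuous_const.sub (continuous_const.mul this)
    have h0 : Filter.Tendsto (fun t => √(‖k t h - k s h‖ ^ 2)) (nhds s) (nhds 0) := by
      simpa only [sub_self, norm_zero, ne_eq, OfNat.ofNat_ne_zero, not_false_eq_true, zero_pow,
        Real.sqrt_zero] using hc.sqrt.tendsto s
    exact h0.congr fun t => Real.sqrt_sq (norm_nonneg _)
  have hadj : ∀ t h, ContinuousLinearMap.adjoint (k 0) (k t h) = twoSided T t h := by
    intro t h
    refine ext_inner_left ℂ fun v => ?_
    rw [ContinuousLinearMap.adjoint_inner_right, hk, zero_sub, ← hT.adjoint_twoSided,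
      ContinuousLinearMap.adjoint_inner_left]
  have hfut : ∀ p : Submodule ℂ K, IsClosed (p : Set K) → (∀ (t : ℝ≥0) h, k t h ∈ p) →
      (Submodule.span ℂ (Set.range fun q : ℝ≥0 × H => k q.1 q.2)).topologicalClosure ≤ p :=
    fun p hp h => Submodule.topologicalClosure_minimal _
      (Submodule.span_le.2 (Set.range_subset_iff.2 fun q => h q.1 q.2)) hp
  have hmem : ∀ (t : ℝ≥0) h, k t h ∈
      (Submodule.span ℂ (Set.range fun q : ℝ≥0 × H => k q.1 q.2)).topologicalClosure := fun t h =>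
    Submodule.le_topologicalClosure _ (Submodule.subset_span ⟨(t, h), rfl⟩)
  have hemb : ((⟨(k 0).toLinearMap, hnorm 0⟩ : H →ₗᵢ[ℂ] K)).toContinuousLinearMap = k 0 := rfl
  refine ⟨K, inferInstance, inferInstance, inferInstance,
    { V := V
      V_zero := fun x => ?_
      V_add := fun s t x => ?_
      continuous_V := fun x => ?_
      emb := ⟨(k 0).toLinearMap, hnorm 0⟩
      future := (Submodule.span ℂ (Set.range fun q : ℝ≥0 × H => k q.1 q.2)).topologicalClosure
      isClosed_future := Submodule.isClosed_topologicalClosure _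
      emb_mem := fun h => hmem 0 h
      V_mem := fun t x hx => ?_
      adjoint_V := fun t x hx => ?_ }, fun q => k q.1 (b q.2), ?_⟩
  · refine htot.induction (p := LinearMap.eqLocus (V 0).toLinearMap LinearMap.id)
      (isClosed_eq (V 0).continuous continuous_id) (fun p => ?_) x
    simp [LinearMap.mem_eqLocus, hV']
  · refine htot.induction
      (p := LinearMap.eqLocus (V (s + t)).toLinearMap ((V s).comp (V t)).toLinearMap)
      (isClosed_eq (V (s + t)).continuous ((V s).comp (V t)).continuous) (fun p => ?_) x
    simp [LinearMap.mem_eqLocus, hV', add_assoc]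
  · obtain ⟨p, hp, hpV⟩ := exists_isClosed_continuous_apply V
    rw [← hpV]
    refine htot.induction hp (fun q => ?_) x
    rw [hpV]
    simp_rw [hV']
    exact (hkc q.2).comp (continuous_id.add continuous_const)
  · refine hfut (Submodule.comap (V t).toLinearMap (Submodule.topologicalClosure _))
      ((Submodule.isClosed_topologicalClosure _).preimage (V t).continuous) (fun s h => ?_) hx
    rw [Submodule.mem_comap]
    erw [hV', ← NNReal.coe_add]
    exact hmem _ _
  · rw [hemb]
    refine hfut (LinearMap.eqLocus
      ((ContinuousLinearMap.adjoint (k 0)).toLinearMap ∘ₗ (V t).toLinearMap)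
      ((T t).toLinearMap ∘ₗ (ContinuousLinearMap.adjoint (k 0)).toLinearMap))
      (isClosed_eq ((ContinuousLinearMap.adjoint (k 0)).continuous.comp (V t).continuous)
        ((T t).continuous.comp (ContinuousLinearMap.adjoint (k 0)).continuous)) (fun s h => ?_) hx
    change ContinuousLinearMap.adjoint (k 0) (V t (k s h))
      = T t (ContinuousLinearMap.adjoint (k 0) (k s h))
    rw [hV', hadj, hadj, ← NNReal.coe_add, twoSided_coe, twoSided_coe, hT.map_add]
    rfl
  -- Rational times suffice because $t \mapsto k_t h$ is continuous.
  · refine isTotalFamily_of_forall_mem fun p hp hpd => htot.induction hp fun q => ?_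
    have h1 : ∀ (r : ℚ) h, k r h ∈ p := fun r h =>
      hb.induction (p := Submodule.comap (k r).toLinearMap p) (hp.preimage (k r).continuous)
        (fun i => hpd (r, i)) h
    have h2 : ∀ t : ℝ, k t q.2 ∈ (p : Set K) :=
      Rat.isDenseEmbedding_coe_real.dense.induction (P := fun t => k t q.2 ∈ (p : Set K))
        (by rintro _ ⟨r, rfl⟩; exact h1 r _) (hp.preimage (hkc q.2))
    exact h2 q.1

end Dilation

/-! ### Comparison of Hilbert dimensions -/

section Cardinality

variable {X Y γ κ : Type v} [NormedAddCommGroup X] [InnerProductSpace ℂ X]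
  [NormedAddCommGroup Y] [InnerProductSpace ℂ Y]

theorem HilbertBasis.isTotalFamily {ι X : Type*} [NormedAddCommGroup X] [InnerProductSpace ℂ X]
    (b : HilbertBasis ι ℂ X) : IsTotalFamily b :=
  b.dense_span

/-- Each basis vector is non-orthogonal to some `d g`, and each `d g` to only countably many basis
vectors. -/
theorem HilbertBasis.mk_le_of_isTotalFamily (b : HilbertBasis κ ℂ X) {d : γ → X}
    (hd : IsTotalFamily d) : Cardinal.mk κ ≤ Cardinal.mk γ * Cardinal.aleph0 := by
  have hex : ∀ i : κ, ∃ g : γ, inner ℂ (b i) (d g) ≠ 0 := by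
    intro i
    by_contra! h
    have h0 : inner ℂ (b i) (b i) = 0 :=
      hd.induction (p := LinearMap.ker (innerSL ℂ (b i)).toLinearMap)
        (ContinuousLinearMap.isClosed_ker (innerSL ℂ (b i))) h (b i)
    exact b.orthonormal.ne_zero i (inner_self_eq_zero.1 h0)
  choose φ hφ using hex
  have hcount : ∀ g : γ, (φ ⁻¹' {g}).Countable := by
    intro g
    have hs := (b.summable_inner_mul_inner (d g) (d g)).countable_support
    refine hs.mono fun i hi => ?_
    have hi' : inner ℂ (b i) (d g) ≠ 0 := by
      have := hφ i
      rwa [show φ i = g from hi] at this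
    exact mul_ne_zero (fun h => hi' (inner_eq_zero_symm.1 h)) hi'
  calc Cardinal.mk κ = Cardinal.mk (⋃ g, φ ⁻¹' {g} : Set κ) := by
        rw [← Set.preimage_iUnion, Set.iUnion_of_singleton, Set.preimage_univ, Cardinal.mk_univ]
    _ ≤ Cardinal.sum fun g => Cardinal.mk (φ ⁻¹' {g} : Set κ) := Cardinal.mk_iUnion_le_sum_mk
    _ ≤ Cardinal.sum fun _ : γ => Cardinal.aleph0 :=
        Cardinal.sum_le_sum _ _ fun g => Cardinal.le_aleph0_iff_set_countable.2 (hcount g)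
    _ = Cardinal.mk γ * Cardinal.aleph0 := by simp

theorem IsTotalFamily.nonempty_linearIsometry [CompleteSpace X] [CompleteSpace Y] {d : γ → X}
    (hd : IsTotalFamily d) [Infinite κ] (hle : Cardinal.mk γ ≤ Cardinal.mk κ) {v : κ → Y}
    (hv : Orthonormal ℂ v) : Nonempty (X →ₗᵢ[ℂ] Y) := by
  classical
  obtain ⟨w, b, -⟩ := exists_hilbertBasis ℂ X
  have hw : Cardinal.mk w ≤ Cardinal.mk κ := by
    refine (b.mk_le_of_isTotalFamily hd).trans ?_
    calc Cardinal.mk γ * Cardinal.aleph0 ≤ Cardinal.mk κ * Cardinal.mk κ :=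
          mul_le_mul' hle (Cardinal.aleph0_le_mk κ)
      _ = Cardinal.mk κ := Cardinal.mul_eq_self (Cardinal.aleph0_le_mk κ)
  obtain ⟨f⟩ := hw
  obtain ⟨L, -⟩ := b.isTotalFamily.exists_linearIsometry (v ∘ f) fun i j => by
    rw [orthonormal_iff_ite.1 b.orthonormal, orthonormal_iff_ite.1 (hv.comp f f.injective)]
  exact ⟨L⟩

theorem HilbertBasis.infinite [CompleteSpace X] (b : HilbertBasis κ ℂ X)
    (hX : ¬ FiniteDimensional ℂ X) : Infinite κ := by
  by_contra h
  rw [not_infinite_iff_finite] at h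
  have := Fintype.ofFinite κ
  exact hX b.toOrthonormalBasis.toBasis.finiteDimensional_of_finite

/-- The orthogonal complement of a finite-dimensional subspace has the same Hilbert dimension as
the whole space if this is infinite. -/
theorem HilbertBasis.mk_le_of_orthogonal [CompleteSpace X] (b : HilbertBasis κ ℂ X)
    (hX : ¬ FiniteDimensional ℂ X) (s : Finset X)
    {w : Type v} (c : HilbertBasis w ℂ (Submodule.span ℂ (s : Set X))ᗮ) :
    Infinite w ∧ Cardinal.mk κ ≤ Cardinal.mk w := by
  set F := Submodule.span ℂ (s : Set X) with hF
  have hsup : F ⊔ Fᗮ = ⊤ := Submodule.sup_orthogonal_of_hasOrthogonalProjection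
  have hw : Infinite w := c.infinite fun hfin => hX <| by
    have : FiniteDimensional ℂ (F ⊔ Fᗮ : Submodule ℂ X) := Submodule.finite_sup _ _
    rw [hsup] at this
    exact Module.Finite.equiv (Submodule.topEquiv (R := ℂ) (M := X))
  refine ⟨hw, ?_⟩
  have htot : IsTotalFamily (Sum.elim (fun x : s => (x : X)) fun i : w => (c i : X)) := by
    refine isTotalFamily_of_forall_mem fun p hp h x => ?_
    have h1 : F ≤ p := Submodule.span_le.2 fun x hx => h (Sum.inl ⟨x, hx⟩)
    have h2 : Fᗮ ≤ p := fun x hx =>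
      c.isTotalFamily.induction (p := p.comap Fᗮ.subtype) (hp.preimage continuous_subtype_val)
        (fun i => h (Sum.inr i)) ⟨x, hx⟩
    exact (hsup ▸ sup_le h1 h2 : (⊤ : Submodule ℂ X) ≤ p) Submodule.mem_top
  have hw' := Cardinal.aleph0_le_mk w
  refine (b.mk_le_of_isTotalFamily htot).trans ?_
  rw [Cardinal.mk_sum, Cardinal.lift_id, Cardinal.lift_id,
    Cardinal.add_eq_right hw' ((Cardinal.mk_le_aleph0).trans hw'),
    Cardinal.mul_eq_left hw' hw' Cardinal.aleph0_ne_zero]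

end Cardinality

/-! ### Construction and transport of unitary representations -/

section Rep

variable {H K : Type*} [NormedAddCommGroup H] [InnerProductSpace ℂ H] [CompleteSpace H]
  [NormedAddCommGroup K] [InnerProductSpace ℂ K] [CompleteSpace K]

theorem exists_unitaryRep_of_isometric (W : ℝ → (H →L[ℂ] H)) (h0 : W 0 = 1)
    (hadd : ∀ s t, W (s + t) = W s * W t) (hnorm : ∀ t x, ‖W t x‖ = ‖x‖)
    (hcont : ∀ x, Continuous fun t => W t x) :
    ∃ U : SOTContinuousUnitaryRep H, ∀ t, U.op t = W t := by
  have hstar : ∀ t, star (W t) * W t = 1 := fun t =>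
    (ContinuousLinearMap.norm_map_iff_adjoint_comp_self (W t)).1 (hnorm t)
  have hinv : ∀ t, W t * W (-t) = 1 := fun t => by rw [← hadd, add_neg_cancel, h0]
  -- The right inverse `W (-t)` must equal the left inverse `star (W t)`, so the isometry is
  -- unitary.
  have hstar' : ∀ t, W t * star (W t) = 1 := fun t => by
    rw [left_inv_eq_right_inv (hstar t) (hinv t), hinv]
  exact ⟨⟨{ toFun := fun t => ⟨W t.toAdd, Unitary.mem_iff.2 ⟨hstar _, hstar' _⟩⟩
            map_one' := Subtype.ext h0
            map_mul' := fun s t => Subtype.ext (hadd s.toAdd t.toAdd) }, hcont⟩, fun t => rfl⟩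

theorem LinearIsometry.adjoint_apply_self (R : K →ₗᵢ[ℂ] H) (x : K) :
    ContinuousLinearMap.adjoint R.toContinuousLinearMap (R x) = x := by
  refine ext_inner_left ℂ fun y => ?_
  rw [ContinuousLinearMap.adjoint_inner_right]
  exact R.inner_map_map y x

/-- Transport of a unitary group on `K` along an isometry `K → H`, with the trivial action on the
orthogonal complement of the range. -/
theorem exists_unitaryRep_of_linearIsometry (V : ℝ → K →ₗᵢ[ℂ] K) (h0 : ∀ x, V 0 x = x)
    (hadd : ∀ s t x, V (s + t) x = V s (V t x)) (hcont : ∀ x, Continuous fun t => V t x)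
    (R : K →ₗᵢ[ℂ] H) :
    ∃ U : SOTContinuousUnitaryRep H, ∀ t x, U.op t x
      = R (V t (ContinuousLinearMap.adjoint R.toContinuousLinearMap x))
        + (x - R (ContinuousLinearMap.adjoint R.toContinuousLinearMap x)) := by
  set A := ContinuousLinearMap.adjoint R.toContinuousLinearMap with hA
  have hAR : ∀ x, A (R x) = x := R.adjoint_apply_self
  have hortho : ∀ y x, inner ℂ (R y) (x - R (A x)) = 0 := by
    intro y x
    have := ContinuousLinearMap.adjoint_inner_right R.toContinuousLinearMap y (x - R (A x))
    rw [← hA, map_sub, hAR, sub_self, inner_zero_right] at this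
    exact this.symm
  suffices h : ∃ U : SOTContinuousUnitaryRep H, ∀ t, U.op t
      = R.toContinuousLinearMap ∘L (V t).toContinuousLinearMap ∘L A
        + (1 - R.toContinuousLinearMap ∘L A) by
    obtain ⟨U, hU⟩ := h
    exact ⟨U, fun t x => by rw [hU]; rfl⟩
  refine exists_unitaryRep_of_isometric (fun t =>
    R.toContinuousLinearMap ∘L (V t).toContinuousLinearMap ∘L A
      + (1 - R.toContinuousLinearMap ∘L A)) ?_ ?_ ?_ ?_
  · ext x
    simp [h0]
  · intro s t
    ext x
    simp [hAR, hadd]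
  · intro t x
    have h1 : ‖R (V t (A x)) + (x - R (A x))‖ ^ 2 = ‖x‖ ^ 2 := by
      have h2 : ‖x‖ ^ 2 = ‖R (A x) + (x - R (A x))‖ ^ 2 := by rw [add_sub_cancel]
      rw [h2, sq, sq, norm_add_sq_eq_norm_sq_add_norm_sq_of_inner_eq_zero _ _ (hortho _ _),
        norm_add_sq_eq_norm_sq_add_norm_sq_of_inner_eq_zero _ _ (hortho _ _)]
      simp only [LinearIsometry.norm_map]
    exact (sq_eq_sq₀ (norm_nonneg _) (norm_nonneg _)).1 h1
  · intro x
    exact (R.continuous.comp (hcont (A x))).add continuous_const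

end Rep

/-! ### Three copies of the space, folded into one -/

section Triple

variable {H : Type*}

variable (H) in
/-- The Hilbert sum of three copies of `H`. -/
abbrev Triple := PiLp 2 fun _ : Fin 3 => H

/-- The element of `Triple H` with given coordinates. -/
def Triple.mk (a b c : H) : Triple H := WithLp.toLp 2 ![a, b, c]

@[simp] theorem Triple.mk_zero (a b c : H) : Triple.mk a b c 0 = a := rfl
@[simp] theorem Triple.mk_one (a b c : H) : Triple.mk a b c 1 = b := rfl
@[simp] theorem Triple.mk_two (a b c : H) : Triple.mk a b c 2 = c := rfl

theorem Triple.ext {x y : Triple H} (h0 : x 0 = y 0) (h1 : x 1 = y 1) (h2 : x 2 = y 2) :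
    x = y := by
  ext i
  fin_cases i <;> assumption

theorem Triple.norm_sq_eq [NormedAddCommGroup H] (x : Triple H) :
    ‖x‖ ^ 2 = ‖x 0‖ ^ 2 + ‖x 1‖ ^ 2 + ‖x 2‖ ^ 2 := by
  rw [PiLp.norm_sq_eq_of_L2, Fin.sum_univ_three]

variable [NormedAddCommGroup H] [InnerProductSpace ℂ H]

theorem Triple.inner_eq (x y : Triple H) :
    inner ℂ x y = inner ℂ (x 0) (y 0) + inner ℂ (x 1) (y 1) + inner ℂ (x 2) (y 2) := by
  rw [PiLp.inner_apply, Fin.sum_univ_three]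

theorem Triple.isTotalFamily {σ : Type*} {b : σ → H} (hb : IsTotalFamily b) :
    IsTotalFamily fun q : Fin 3 × σ => (PiLp.single 2 q.1 (b q.2) : Triple H) := by
  refine isTotalFamily_of_forall_mem fun p hp h x => ?_
  have hs : ∀ i (u : H), (PiLp.single 2 i u : Triple H) ∈ p := by
    intro i u
    let L : H →L[ℂ] Triple H :=
      (PiLp.continuousLinearEquiv 2 ℂ fun _ : Fin 3 => H).symm.toContinuousLinearMap ∘L
        ContinuousLinearMap.single ℂ (fun _ : Fin 3 => H) i
    exact hb.induction (p := p.comap L.toLinearMap) (hp.preimage L.continuous)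
      (fun j => h (i, j)) u
  have : x = PiLp.single 2 0 (x 0) + PiLp.single 2 1 (x 1) + PiLp.single 2 2 (x 2) := by
    refine Triple.ext ?_ ?_ ?_ <;> simp
  rw [this]
  exact p.add_mem (p.add_mem (hs _ _) (hs _ _)) (hs _ _)

/-- A finite-dimensional subspace of the first summand can be fixed by an isometry of `Triple H`
into `H`. -/
theorem exists_linearIsometry_triple {H : Type v} [NormedAddCommGroup H] [InnerProductSpace ℂ H]
    [CompleteSpace H] (hH : ¬ FiniteDimensional ℂ H) (s : Finset H) :
    ∃ w : Triple H →ₗᵢ[ℂ] H, ∀ x ∈ s, w (Triple.mk x 0 0) = x := by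
  obtain ⟨σ, b, -⟩ := exists_hilbertBasis ℂ H
  set F := Submodule.span ℂ (s : Set H) with hF
  obtain ⟨κ, c, -⟩ := exists_hilbertBasis ℂ Fᗮ
  obtain ⟨hκ, hle⟩ := b.mk_le_of_orthogonal hH s c
  have hle3 : Cardinal.mk (Fin 3 × σ) ≤ Cardinal.mk κ := by
    have hκ' := Cardinal.aleph0_le_mk κ
    rw [Cardinal.mk_prod, Cardinal.lift_uzero]
    calc Cardinal.lift.{v} (Cardinal.mk (Fin 3)) * Cardinal.mk σ
        ≤ Cardinal.mk κ * Cardinal.mk κ := mul_le_mul' (by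
          refine le_trans ?_ hκ'
          simp) hle
      _ = Cardinal.mk κ := Cardinal.mul_eq_self hκ'
  obtain ⟨e⟩ := (Triple.isTotalFamily b.isTotalFamily).nonempty_linearIsometry hle3 c.orthonormal
  have hmk : ∀ x y : H, Triple.mk (x + y) 0 0 = Triple.mk x 0 0 + Triple.mk y 0 0 := fun x y => by
    refine Triple.ext ?_ ?_ ?_ <;> simp
  have hmk' : ∀ (r : ℂ) (x : H), Triple.mk (r • x) 0 0 = r • Triple.mk x 0 0 := fun r x => by
    refine Triple.ext ?_ ?_ ?_ <;> simp
  -- The part of the first coordinate in `F` stays put; `e` sends the remainder into `Fᗮ`, so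
  -- Pythagoras gives isometry.
  refine ⟨⟨{ toFun := fun x => F.starProjection (x 0)
                + (e (x - Triple.mk (F.starProjection (x 0)) 0 0) : H)
             map_add' := fun x y => ?_
             map_smul' := fun r x => ?_ }, fun x => ?_⟩, fun x hx => ?_⟩
  · simp only [PiLp.add_apply, map_add, hmk, add_sub_add_comm, Submodule.coe_add]
    abel
  · simp only [PiLp.smul_apply, map_smul, hmk', ← smul_sub, Submodule.coe_smul, RingHom.id_apply,
      smul_add]
  · have hperp : ∀ (u : H) (z : Fᗮ), inner ℂ (F.starProjection u) (z : H) = 0 := fun u z =>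
      z.2 _ (F.starProjection_apply_mem u)
    have h1 : ‖F.starProjection (x 0) + (e (x - Triple.mk (F.starProjection (x 0)) 0 0) : H)‖ ^ 2
        = ‖x‖ ^ 2 := by
      have h2 : ‖x 0‖ ^ 2 = ‖F.starProjection (x 0)‖ ^ 2 + ‖x 0 - F.starProjection (x 0)‖ ^ 2 := by
        have := norm_add_sq_eq_norm_sq_add_norm_sq_of_inner_eq_zero (𝕜 := ℂ)
          (F.starProjection (x 0)) (x 0 - F.starProjection (x 0))
          (hperp _ ⟨_, F.sub_starProjection_mem_orthogonal (x 0)⟩)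
        rwa [add_sub_cancel, ← sq, ← sq, ← sq] at this
      rw [sq, norm_add_sq_eq_norm_sq_add_norm_sq_of_inner_eq_zero _ _ (hperp _ _), ← sq, ← sq,
        ← Submodule.coe_norm, e.norm_map, Triple.norm_sq_eq, Triple.norm_sq_eq]
      simp only [PiLp.sub_apply, Triple.mk_zero, Triple.mk_one, Triple.mk_two, sub_zero]
      rw [h2]
      ring
    exact (sq_eq_sq₀ (norm_nonneg _) (norm_nonneg _)).1 h1
  · have hxF : F.starProjection x = x :=
      Submodule.starProjection_eq_self_iff.2 (Submodule.subset_span hx)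
    change F.starProjection x + (e (Triple.mk x 0 0 - Triple.mk (F.starProjection x) 0 0) : H) = x
    rw [hxF, sub_self, map_zero, Submodule.coe_zero, add_zero]

end Triple

/-! ### Unitary groups on the original space -/

section Assembly

variable {H : Type v} [NormedAddCommGroup H] [InnerProductSpace ℂ H] [CompleteSpace H]
  {K : Type*} [NormedAddCommGroup K] [InnerProductSpace ℂ K] [CompleteSpace K]
  {T : ℝ≥0 → (H →L[ℂ] H)}

/-- The coordinates of `J` follow $K = H \oplus (\text{future} \ominus H) \oplus
\text{future}^\perp$, with `e` copying the last two summands into $H$. -/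
theorem UnitaryDilation.exists_linearIsometry_triple (D : UnitaryDilation T K) (e : K →ₗᵢ[ℂ] H) :
    ∃ J : K →ₗᵢ[ℂ] Triple H,
      (∀ x, J x 0 = ContinuousLinearMap.adjoint D.emb.toContinuousLinearMap x) ∧
      (∀ x ∈ D.future, J x 2 = 0) ∧
      (∀ h, J (D.emb h) = Triple.mk h 0 0) ∧
      ∀ b : Triple H, b 2 = 0 →
        ContinuousLinearMap.adjoint J.toContinuousLinearMap b ∈ D.future := by
  have : CompleteSpace D.future := D.isClosed_future.completeSpace_coe
  set P := D.future.starProjection with hP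
  set A := ContinuousLinearMap.adjoint D.emb.toContinuousLinearMap with hA
  have hPmem : ∀ x ∈ D.future, P x = x := fun x hx => Submodule.starProjection_eq_self_iff.2 hx
  have hAP : ∀ x, A (P x) = A x := by
    intro x
    refine ext_inner_left ℂ fun v => ?_
    rw [hA, ContinuousLinearMap.adjoint_inner_right, ContinuousLinearMap.adjoint_inner_right,
      ← Submodule.inner_starProjection_left_eq_right]
    exact congrArg (fun z => inner ℂ z x) (hPmem _ (D.emb_mem v))
  have hnorm : ∀ x, ‖x‖ ^ 2 = ‖A x‖ ^ 2 + ‖P x - D.emb (A x)‖ ^ 2 + ‖x - P x‖ ^ 2 := by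
    intro x
    have h1 := norm_add_sq_eq_norm_sq_add_norm_sq_of_inner_eq_zero (𝕜 := ℂ) (P x) (x - P x)
      (D.future.sub_starProjection_mem_orthogonal x _ (D.future.starProjection_apply_mem x))
    have h2 := norm_add_sq_eq_norm_sq_add_norm_sq_of_inner_eq_zero (𝕜 := ℂ) (D.emb (A x))
      (P x - D.emb (A x)) (by
        have := ContinuousLinearMap.adjoint_inner_right D.emb.toContinuousLinearMap (A x)
          (P x - D.emb (A x))
        rw [← hA, map_sub, hAP, D.emb.adjoint_apply_self, sub_self, inner_zero_right] at this
        exact this.symm)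
    rw [add_sub_cancel, ← sq, ← sq, ← sq] at h1 h2
    rw [h1, h2, D.emb.norm_map]
  let J : K →ₗᵢ[ℂ] Triple H :=
    ⟨{ toFun := fun x => Triple.mk (A x) (e (P x - D.emb (A x))) (e (x - P x))
       map_add' := fun x y => Triple.ext (by simp) (by simp; abel) (by simp; abel)
       map_smul' := fun r x => Triple.ext (by simp) (by simp [smul_sub]) (by simp [smul_sub]) },
     fun x => by
       refine (sq_eq_sq₀ (norm_nonneg _) (norm_nonneg _)).1 ?_
       rw [Triple.norm_sq_eq, hnorm]
       simp [-map_sub]⟩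
  have hJ : ∀ x, J x = Triple.mk (A x) (e (P x - D.emb (A x))) (e (x - P x)) := fun x => rfl
  refine ⟨J, fun x => rfl, fun x hx => ?_, fun h => ?_, fun b hb => ?_⟩
  · rw [hJ, Triple.mk_two, hPmem x hx, sub_self, map_zero]
  · rw [hJ, hPmem _ (D.emb_mem h), D.emb.adjoint_apply_self, sub_self, map_zero]
  -- `J` sends the complement of the future to the third coordinate, where `b` vanishes; closedness
  -- of the future then puts the adjoint image in it.
  · rw [← D.future.orthogonal_orthogonal]
    intro z hz
    have hPz : P z = 0 := (Submodule.starProjection_apply_eq_zero_iff _).2 hz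
    rw [ContinuousLinearMap.adjoint_inner_right]
    change inner ℂ (J z) b = 0
    have hAz : A z = 0 := by rw [← hAP, hPz, map_zero]
    rw [hJ, Triple.inner_eq, hb, hAz, hPz]
    simp

/-- The unitary group on `H` obtained from a unitary dilation by embedding the dilation space in
`Triple H`, and this in `H`. -/
theorem UnitaryDilation.exists_unitaryRep (D : UnitaryDilation T K) (e : K →ₗᵢ[ℂ] H)
    (w : Triple H →ₗᵢ[ℂ] H) :
    ∃ U : SOTContinuousUnitaryRep H, ∀ (t : ℝ≥0) (b : Triple H), b 2 = 0 →
      ∃ b' : Triple H, U.op t (w b) = w b' ∧ b' 2 = 0 ∧ b' 0 = T t (b 0) := by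
  obtain ⟨J, hJ0, hJ2, hJe, hJa⟩ := D.exists_linearIsometry_triple e
  obtain ⟨U, hU⟩ := exists_unitaryRep_of_linearIsometry D.V D.V_zero D.V_add D.continuous_V
    (w.comp J)
  refine ⟨U, fun t b hb => ?_⟩
  set y := ContinuousLinearMap.adjoint J.toContinuousLinearMap b with hy
  have hyf : y ∈ D.future := hJa b hb
  have hwy : ContinuousLinearMap.adjoint (w.comp J).toContinuousLinearMap (w b) = y := by
    refine ext_inner_left ℂ fun v => ?_
    rw [ContinuousLinearMap.adjoint_inner_right, hy, ContinuousLinearMap.adjoint_inner_right]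
    exact w.inner_map_map (J v) b
  have hy0 : ContinuousLinearMap.adjoint D.emb.toContinuousLinearMap y = b 0 := by
    refine ext_inner_left ℂ fun v => ?_
    rw [ContinuousLinearMap.adjoint_inner_right, hy, ContinuousLinearMap.adjoint_inner_right]
    change inner ℂ (J (D.emb v)) b = _
    rw [hJe, Triple.inner_eq]
    simp
  -- The group moves `J y` by `V` and fixes `b - J y`, whose first and third coordinates are zero.
  refine ⟨J (D.V t y) + (b - J y), ?_, ?_, ?_⟩
  · rw [hU, hwy, map_add, map_sub]
    rfl
  · rw [PiLp.add_apply, PiLp.sub_apply, hJ2 _ (D.V_mem t y hyf), hJ2 y hyf, hb, sub_zero, add_zero]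
  · rw [PiLp.add_apply, PiLp.sub_apply, hJ0, hJ0, D.adjoint_V t y hyf, hy0, sub_self, add_zero]

theorem IsContractiveC0Semigroup.exists_unitaryRep (hH : ¬ FiniteDimensional ℂ H)
    (hT : IsContractiveC0Semigroup T) (w : Triple H →ₗᵢ[ℂ] H) :
    ∃ U : SOTContinuousUnitaryRep H, ∀ (t : ℝ≥0) (b : Triple H), b 2 = 0 →
      ∃ b' : Triple H, U.op t (w b) = w b' ∧ b' 2 = 0 ∧ b' 0 = T t (b 0) := by
  obtain ⟨σ, b, -⟩ := exists_hilbertBasis ℂ H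
  have hσ : Infinite σ := b.infinite hH
  have hσ' := Cardinal.aleph0_le_mk σ
  obtain ⟨K, _, _, _, D, d, hd⟩ := hT.exists_unitaryDilation b.isTotalFamily
  have hle : Cardinal.mk (ℚ × σ) ≤ Cardinal.mk σ := by
    rw [Cardinal.mk_prod, Cardinal.lift_uzero]
    calc Cardinal.lift.{v} (Cardinal.mk ℚ) * Cardinal.mk σ
        ≤ Cardinal.mk σ * Cardinal.mk σ := by
          refine mul_le_mul' (le_trans ?_ hσ') le_rfl
          simp
      _ = Cardinal.mk σ := Cardinal.mul_eq_self hσ'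
  obtain ⟨e⟩ := hd.nonempty_linearIsometry hle b.orthonormal
  exact D.exists_unitaryRep e w

/-- The condition `b 2 = 0` does not involve the index, so it passes from factor to factor; the
middle coordinate is left uncontrolled. -/
theorem exists_prod_apply_eq {I : Type*} {T : I → ℝ≥0 → (H →L[ℂ] H)} (w : Triple H →ₗᵢ[ℂ] H)
    {U : I → SOTContinuousUnitaryRep H}
    (hU : ∀ i (t : ℝ≥0) (b : Triple H), b 2 = 0 →
      ∃ b' : Triple H, (U i).op t (w b) = w b' ∧ b' 2 = 0 ∧ b' 0 = T i t (b 0))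
    (l : List (I × ℝ≥0)) (b : Triple H) (hb : b 2 = 0) :
    ∃ b' : Triple H, (l.map fun p => (U p.1).op (p.2 : ℝ)).prod (w b) = w b' ∧ b' 2 = 0 ∧
      b' 0 = (l.map fun p => T p.1 p.2).prod (b 0) := by
  induction l with
  | nil => exact ⟨b, rfl, hb, rfl⟩
  | cons p l ih =>
    obtain ⟨b₁, h1, h2, h3⟩ := ih
    obtain ⟨b₂, h4, h5, h6⟩ := hU p.1 p.2 b₁ h2
    refine ⟨b₂, ?_, h5, ?_⟩
    · rw [List.map_cons, List.prod_cons, ← h4, ← h1]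
      rfl
    · rw [List.map_cons, List.prod_cons, h6, h3]
      rfl

end Assembly

/-- The products are ordered with the factor `k = 0` leftmost; the supremum is taken in `[0, ∞]`
over all word lengths `N ≥ 0`, all words `i` of length `N` and all times `t`. -/
theorem mainTheorem8 {I : Type u} [Nonempty I]
    {H : Type v} [NormedAddCommGroup H] [InnerProductSpace ℂ H] [CompleteSpace H]
    (hH : ¬ FiniteDimensional ℂ H)
    (hI : Cardinal.lift.{v} (Cardinal.mk I) ≤ Cardinal.lift.{u} (hilbertDim H))
    (T : I → ℝ≥0 → (H →L[ℂ] H)) (hT : ∀ i, IsContractiveC0Semigroup (T i)) :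
    ∃ (Λ : Type v) (_ : Preorder Λ) (_ : IsDirectedOrder Λ) (_ : Nonempty Λ)
      (U : Λ → I → SOTContinuousUnitaryRep H),
      ∀ ξ η : H,
        Filter.Tendsto
          (fun α : Λ => ⨆ (N : ℕ) (i : Fin N → I) (t : Fin N → ℝ≥0),
            ‖inner ℂ η (((List.ofFn fun k => T (i k) (t k)).prod
              - (List.ofFn fun k => (U α (i k)).op (t k : ℝ)).prod) ξ)‖ₑ)
          Filter.atTop (nhds (0 : ℝ≥0∞)) := by
  classical
  choose w hw using fun s : Finset H => exists_linearIsometry_triple hH s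
  choose U hU using fun (s : Finset H) (i : I) => (hT i).exists_unitaryRep hH (w s)
  refine ⟨Finset H, inferInstance, inferInstance, inferInstance, U, fun ξ η => ?_⟩
  refine tendsto_const_nhds.congr' ?_
  filter_upwards [Filter.eventually_ge_atTop ({ξ, η} : Finset H)] with s hs
  have hξ : w s (Triple.mk ξ 0 0) = ξ := hw s ξ (hs (by simp))
  have hη : w s (Triple.mk η 0 0) = η := hw s η (hs (by simp))
  symm
  simp only [ENNReal.iSup_eq_zero]
  intro N i t
  obtain ⟨b, h1, -, h3⟩ := exists_prod_apply_eq (w s) (hU s) (List.ofFn fun k => (i k, t k))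
    (Triple.mk ξ 0 0) rfl
  rw [List.map_ofFn, hξ] at h1
  rw [List.map_ofFn, Triple.mk_zero] at h3
  have h4 : inner ℂ η ((List.ofFn fun k => (U s (i k)).op (t k : ℝ)).prod ξ)
      = inner ℂ η ((List.ofFn fun k => T (i k) (t k)).prod ξ) := by
    -- Since $\eta = w(\eta,0,0)$, pairing with $\eta$ sees only the first coordinate of `b`.
    calc inner ℂ η ((List.ofFn fun k => (U s (i k)).op (t k : ℝ)).prod ξ)
        = inner ℂ (w s (Triple.mk η 0 0)) (w s b) := by rw [hη, ← h1]; rfl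
      _ = inner ℂ η (b 0) := by
        rw [(w s).inner_map_map, Triple.inner_eq]
        simp
      _ = _ := by rw [h3]; rfl
  rw [sub_apply, inner_sub_right, h4, sub_self, enorm_zero]
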